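/- Let $A$ be a simple unital $C^*$-algebra and let $\alpha\colon G \to \mathrm{Aut}(A)$ be an action of a finite group $G$ on $A$ by $*$-automorphisms. Let $A^\infty = \ell^\infty(\mathbb{N}, A)/c_0(A)$, where $c_0(A)$ is the ideal of sequences that converge to $0$ in norm; embed $A$ into $A^\infty$ as the classes of constant sequences, put $A_\infty = A^\infty \cap A'$ (the elements of $A^\infty$ that commute with $A$), and let $(\alpha_g)_\infty$ be the automorphism of $A_\infty$ that $\alpha_g$ induces by termwise application. Suppose that $\alpha$ has the Rokhlin property: there are projections $e_g \in A_\infty$ ($g \in G$) with $\sum_{g\in G} e_g = 1$ and $(\alpha_g)_\infty(e_h) = e_{gh}$ for all $g, h \in G$. Say that a $C^*$-algebra has the LP property if the complex linear span of its projections is norm dense in it. If $A$ has the LP property, then the fixed point algebra $A^\alpha = \{a \in A : \alpha_g(a) = a \text{ for all } g \in G\}$ and the crossed product $A \rtimes_\alpha G$ both have the LP property. -/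

import Mathlib

noncomputable section

namespace RokhlinLP

/-! ### The LP property and simplicity -/

/-- A C⋆-algebra has the LP property if the set of all (complex) linear combinations of its
projections (self-adjoint idempotents) is norm dense. -/
def HasLP (B : Type*) [CStarAlgebra B] : Prop :=
  Dense (Submodule.span ℂ {p : B | IsStarProjection p} : Set B)

/-- A C⋆-algebra is simple if it is nonzero and has no closed two-sided ideals besides `0` and
itself. -/
structure IsSimpleCStar (A : Type*) [CStarAlgebra A] : Prop where
  nontrivial : Nontrivial A
  eq_bot_or_eq_top : ∀ I : TwoSidedIdeal A, IsClosed (I : Set A) → I = ⊥ ∨ I = ⊤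

/-! ### The fixed point algebra -/

section FixedPoints

variable {G A : Type*} [Group G] [CStarAlgebra A]

/-- Star automorphisms of a C⋆-algebra are isometric. -/
lemma isometry_starAut (φ : A ≃⋆ₐ[ℂ] A) : Isometry φ :=
  NonUnitalStarAlgHom.isometry (φ : A →⋆ₙₐ[ℂ] A) φ.injective

/-- The fixed point algebra `{a | α_g(a) = a for all g}` of an action `α`. -/
def fixedPointAlgebra (α : G →* (A ≃⋆ₐ[ℂ] A)) : StarSubalgebra ℂ A where
  carrier := {a | ∀ g, α g a = a}
  mul_mem' ha hb g := by rw [map_mul, ha g, hb g]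
  add_mem' ha hb g := by rw [map_add, ha g, hb g]
  algebraMap_mem' r g := by
    rw [Algebra.algebraMap_eq_smul_one, map_smul, map_one]
  star_mem' ha g := by rw [map_star, ha g]

instance isClosed_fixedPointAlgebra (α : G →* (A ≃⋆ₐ[ℂ] A)) :
    IsClosed (fixedPointAlgebra α : Set A) := by
  have : (fixedPointAlgebra α : Set A) = ⋂ g, {a | α g a = a} := by
    ext a; simp [fixedPointAlgebra]
  rw [this]
  exact isClosed_iInter fun g => isClosed_eq (isometry_starAut (α g)).continuous continuous_id

end FixedPoints

/-! ### The sequence algebra and the Rokhlin property -/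

section Sequences

open BoundedContinuousFunction

variable (A : Type*) [CStarAlgebra A]

/-- `ℓ^∞(ℕ, A)`: since `ℕ` is discrete, the bounded continuous functions `ℕ → A` are exactly the
bounded sequences. -/
abbrev BddSeq : Type _ := ℕ →ᵇ A

/-- The ideal `c₀(A)` of the sequences in `ℓ^∞(ℕ, A)` that converge to `0` in norm. -/
def c0 : Ideal (BddSeq A) where
  carrier := {a | Filter.Tendsto (fun n => ‖a n‖) Filter.atTop (nhds 0)}
  zero_mem' := by simp
  add_mem' {a b} ha hb := by
    refine squeeze_zero (fun n => norm_nonneg _) (fun n => norm_add_le (a n) (b n)) ?_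
    simpa using Filter.Tendsto.add ha hb
  smul_mem' c a ha := by
    refine squeeze_zero (fun n => norm_nonneg _) (g := fun n => ‖c‖ * ‖a n‖) (fun n => ?_) ?_
    · exact (norm_mul_le _ _).trans
        (mul_le_mul_of_nonneg_right (c.norm_coe_le_norm n) (norm_nonneg _))
    · simpa using Filter.Tendsto.const_mul ‖c‖ ha

instance : (c0 A).IsTwoSided where
  mul_mem_of_left {a} b ha := by
    refine squeeze_zero (fun n => norm_nonneg _) (g := fun n => ‖a n‖ * ‖b‖) (fun n => ?_) ?_
    · exact (norm_mul_le _ _).trans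
        (mul_le_mul_of_nonneg_left (b.norm_coe_le_norm n) (norm_nonneg _))
    · simpa using Filter.Tendsto.mul_const ‖b‖ ha

/-- The sequence algebra `A^∞ = ℓ^∞(ℕ, A) / c₀(A)`. -/
abbrev SeqAlg : Type _ := BddSeq A ⧸ c0 A

/-- The involution of `A^∞`, induced by the pointwise involution of sequences. -/
instance : StarRing (SeqAlg A) where
  star := Quotient.map' star (by
    intro a b hab
    rw [Submodule.quotientRel_def] at hab ⊢
    rw [← star_sub]
    change Filter.Tendsto (fun n => ‖star ((a - b) n)‖) Filter.atTop (nhds 0)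
    simp only [norm_star]
    exact hab)
  star_involutive := by
    rintro ⟨a⟩
    exact congrArg (Ideal.Quotient.mk (c0 A)) (star_star a)
  star_mul := by
    rintro ⟨a⟩ ⟨b⟩
    exact congrArg (Ideal.Quotient.mk (c0 A)) (star_mul a b)
  star_add := by
    rintro ⟨a⟩ ⟨b⟩
    exact congrArg (Ideal.Quotient.mk (c0 A)) (star_add a b)

lemma star_mk (a : BddSeq A) :
    star (Ideal.Quotient.mk (c0 A) a) = Ideal.Quotient.mk (c0 A) (star a) := rfl

variable {A}

/-- The class in `A^∞` of a constant sequence. -/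
def constSeq (a : A) : SeqAlg A := Ideal.Quotient.mk (c0 A) (BoundedContinuousFunction.const ℕ a)

variable (A) in
/-- `A_∞ = A^∞ ∩ A'`: the elements of the sequence algebra that commute with (the classes of
constant sequences of) all elements of `A`. -/
def centralSeqAlg : Subring (SeqAlg A) := Subring.centralizer (Set.range (constSeq (A := A)))

/-- The pointwise application of a star automorphism `φ` to bounded sequences. -/
def bddSeqMap (φ : A ≃⋆ₐ[ℂ] A) : BddSeq A →+* BddSeq A where
  toFun a := BoundedContinuousFunction.ofNormedAddCommGroupDiscrete (fun n => φ (a n)) ‖a‖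
    (fun n => ((isometry_starAut φ).norm_map_of_map_zero (map_zero φ) (a n)).le.trans
      (a.norm_coe_le_norm n))
  map_one' := by ext n; exact map_one φ
  map_mul' a b := by ext n; exact map_mul φ (a n) (b n)
  map_zero' := by ext n; exact map_zero φ
  map_add' a b := by ext n; exact map_add φ (a n) (b n)

/-- The map `φ^∞` of `A^∞` induced by a star automorphism `φ` of `A`. -/
def seqAlgMap (φ : A ≃⋆ₐ[ℂ] A) : SeqAlg A →+* SeqAlg A :=
  Ideal.quotientMap (c0 A) (bddSeqMap φ) (by
    intro a ha
    change Filter.Tendsto (fun n => ‖φ (a n)‖) Filter.atTop (nhds 0)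
    have h : ∀ n, ‖φ (a n)‖ = ‖a n‖ := fun n =>
      (isometry_starAut φ).norm_map_of_map_zero (map_zero φ) (a n)
    simp only [h]
    exact ha)

/-- The Rokhlin property of Izumi for an action `α` of a finite group: there is a partition of
unity `(e_g)` in `A_∞` consisting of projections, with `(α_g)_∞ (e_h) = e_{gh}`. -/
def HasRokhlin {G : Type*} [Group G] [Fintype G] (α : G →* (A ≃⋆ₐ[ℂ] A)) : Prop :=
  ∃ e : G → SeqAlg A,
    (∀ g, e g ∈ centralSeqAlg A) ∧
    (∀ g, IsStarProjection (e g)) ∧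
    ∑ g, e g = 1 ∧
    ∀ g h, seqAlgMap (α g) (e h) = e (g * h)

end Sequences

/-! ### The crossed product by a finite group -/

/-- The crossed product `A ⋊_α G` by a finite group `G`. An element is a family `f : G → A`, which
stands for the sum `∑ g, f g u_g`, where `u_g` are the canonical unitaries, with
`u_g a u_g⋆ = α_g(a)`. For finite `G` these sums already form a C⋆-algebra, which is constructed
below: the product is the twisted convolution, and the norm is the operator norm in the regular
representation on the Hilbert module `ℓ²(G, A)`. -/
def CrossedProduct {G A : Type*} [Group G] [CStarAlgebra A] (_α : G →* (A ≃⋆ₐ[ℂ] A)) : Type _ :=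
  G → A

namespace CrossedProduct

variable {G A : Type*} [Group G] [CStarAlgebra A] {α : G →* (A ≃⋆ₐ[ℂ] A)}

instance : AddCommGroup (CrossedProduct α) := inferInstanceAs (AddCommGroup (G → A))

instance : Module ℂ (CrossedProduct α) := inferInstanceAs (Module ℂ (G → A))

/-- The coefficient of `u_g`, as a function of `g`. -/
def coeff (f : CrossedProduct α) : G → A := f

/-- The element `∑ g, f g u_g`. -/
def ofCoeff (α : G →* (A ≃⋆ₐ[ℂ] A)) (f : G → A) : CrossedProduct α := f

@[ext] lemma ext {f h : CrossedProduct α} (H : ∀ g, f.coeff g = h.coeff g) : f = h := funext H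

@[simp] lemma coeff_ofCoeff (f : G → A) : (ofCoeff α f).coeff = f := rfl
@[simp] lemma coeff_zero (g : G) : (0 : CrossedProduct α).coeff g = 0 := rfl
@[simp] lemma coeff_add (f h : CrossedProduct α) (g : G) :
    (f + h).coeff g = f.coeff g + h.coeff g := rfl
@[simp] lemma coeff_smul (c : ℂ) (f : CrossedProduct α) (g : G) :
    (c • f).coeff g = c • f.coeff g := rfl

set_option linter.unusedSectionVars false

variable [Fintype G] [DecidableEq G]

/-- The unit is `u_1`. -/
instance : One (CrossedProduct α) := ⟨ofCoeff α (Pi.single 1 1)⟩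

/-- Twisted convolution: `(a u_k)(b u_h) = a α_k(b) u_{kh}`. -/
instance : Mul (CrossedProduct α) :=
  ⟨fun f h => ofCoeff α fun g => ∑ k, f.coeff k * α k (h.coeff (k⁻¹ * g))⟩

/-- The involution: `(a u_g)⋆ = α_{g⁻¹}(a⋆) u_{g⁻¹}`. -/
instance : Star (CrossedProduct α) :=
  ⟨fun f => ofCoeff α fun g => α g (star (f.coeff g⁻¹))⟩

lemma coeff_one (g : G) : (1 : CrossedProduct α).coeff g = if g = 1 then 1 else 0 := by
  change (Pi.single 1 1 : G → A) g = _
  rw [Pi.single_apply]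

lemma coeff_mul (f h : CrossedProduct α) (g : G) :
    (f * h).coeff g = ∑ k, f.coeff k * α k (h.coeff (k⁻¹ * g)) := rfl

lemma coeff_star (f : CrossedProduct α) (g : G) :
    (star f).coeff g = α g (star (f.coeff g⁻¹)) := rfl

lemma act_mul (g h : G) (a : A) : α (g * h) a = α g (α h a) := by
  rw [map_mul]; rfl

lemma act_one (a : A) : α 1 a = a := by
  rw [map_one]; rfl

/-- The matrix over `A` of `∑ g, f g u_g` in the regular representation on `ℓ²(G, A)`, given by
`(a ξ)(s) = α_{s⁻¹}(a) ξ(s)` and `(u_g ξ)(s) = ξ(g⁻¹ s)`. -/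
def regMatrix (f : CrossedProduct α) : CStarMatrix G G A :=
  CStarMatrix.ofMatrix fun s t => α s⁻¹ (f.coeff (s * t⁻¹))

lemma regMatrix_apply (f : CrossedProduct α) (s t : G) :
    regMatrix f s t = α s⁻¹ (f.coeff (s * t⁻¹)) := rfl

lemma regMatrix_injective : Function.Injective (regMatrix (α := α)) := by
  intro f h H
  ext g
  have := congrFun (congrFun H g) 1
  rw [regMatrix_apply, regMatrix_apply] at this
  simpa using (α g⁻¹).injective this

lemma regMatrix_add (f h : CrossedProduct α) : regMatrix (f + h) = regMatrix f + regMatrix h := by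
  ext s t; simp [regMatrix_apply]

lemma regMatrix_zero : regMatrix (0 : CrossedProduct α) = 0 := by
  ext s t; simp [regMatrix_apply]

lemma regMatrix_smul (c : ℂ) (f : CrossedProduct α) : regMatrix (c • f) = c • regMatrix f := by
  ext s t; simp [regMatrix_apply]

lemma regMatrix_one : regMatrix (1 : CrossedProduct α) = 1 := by
  ext s t
  rw [regMatrix_apply, coeff_one]
  by_cases h : s = t
  · subst h; simp
  · rw [if_neg (by rwa [mul_inv_eq_one]), map_zero, CStarMatrix.one_apply_ne h]

lemma regMatrix_mul (f h : CrossedProduct α) : regMatrix (f * h) = regMatrix f * regMatrix h := by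
  ext s t
  rw [CStarMatrix.mul_apply, regMatrix_apply, coeff_mul, map_sum]
  refine Fintype.sum_equiv ((Equiv.inv G).trans (Equiv.mulRight s)) _ _ fun k => ?_
  rw [regMatrix_apply, regMatrix_apply, map_mul, ← act_mul]
  simp [mul_assoc]

lemma regMatrix_star (f : CrossedProduct α) : regMatrix (star f) = star (regMatrix f) := by
  ext s t
  rw [CStarMatrix.star_apply, regMatrix_apply, regMatrix_apply, coeff_star, ← act_mul, map_star]
  simp

instance : Ring (CrossedProduct α) where
  __ := (inferInstance : AddCommGroup (CrossedProduct α))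
  mul_assoc a b c := regMatrix_injective (by simp only [regMatrix_mul, mul_assoc])
  one_mul a := regMatrix_injective (by simp only [regMatrix_mul, regMatrix_one, one_mul])
  mul_one a := regMatrix_injective (by simp only [regMatrix_mul, regMatrix_one, mul_one])
  left_distrib a b c := regMatrix_injective (by simp only [regMatrix_mul, regMatrix_add, mul_add])
  right_distrib a b c := regMatrix_injective (by simp only [regMatrix_mul, regMatrix_add, add_mul])
  zero_mul a := regMatrix_injective (by simp only [regMatrix_mul, regMatrix_zero, zero_mul])
  mul_zero a := regMatrix_injective (by simp only [regMatrix_mul, regMatrix_zero, mul_zero])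

instance : StarRing (CrossedProduct α) where
  star_involutive a := regMatrix_injective (by simp only [regMatrix_star, star_star])
  star_mul a b := regMatrix_injective (by simp only [regMatrix_star, regMatrix_mul, star_mul])
  star_add a b := regMatrix_injective (by simp only [regMatrix_star, regMatrix_add, star_add])

instance : Algebra ℂ (CrossedProduct α) :=
  Algebra.ofModule
    (fun c a b => regMatrix_injective (by
      simp only [regMatrix_mul, regMatrix_smul, smul_mul_assoc]))
    (fun c a b => regMatrix_injective (by
      simp only [regMatrix_mul, regMatrix_smul, mul_smul_comm]))

instance : StarModule ℂ (CrossedProduct α) where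
  star_smul c a := regMatrix_injective (by
    simp only [regMatrix_star, regMatrix_smul, star_smul])

/-- The regular representation, a faithful unital star homomorphism into the C⋆-algebra of
`G × G` matrices over `A`. -/
def regRep (α : G →* (A ≃⋆ₐ[ℂ] A)) : CrossedProduct α →⋆ₐ[ℂ] CStarMatrix G G A where
  toFun := regMatrix
  map_one' := regMatrix_one
  map_mul' := regMatrix_mul
  map_zero' := regMatrix_zero
  map_add' := regMatrix_add
  commutes' c := by
    rw [Algebra.algebraMap_eq_smul_one, Algebra.algebraMap_eq_smul_one, regMatrix_smul,
      regMatrix_one]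
  map_star' := regMatrix_star

/-- A matrix is in the image of the regular representation iff `α_s(M s t)` depends on `s t⁻¹`
only, which is a closed condition. -/
lemma isClosed_range_regRep : IsClosed (Set.range (regRep α)) := by
  have hr : Set.range (regRep α) =
      ⋂ s, ⋂ t, {M : CStarMatrix G G A | M s t = α s⁻¹ (α (s * t⁻¹) (M (s * t⁻¹) 1))} := by
    ext M
    simp only [Set.mem_range, Set.mem_iInter, Set.mem_ofPred_eq]
    constructor
    · rintro ⟨f, rfl⟩ s t
      change regMatrix f s t = α s⁻¹ (α (s * t⁻¹) (regMatrix f (s * t⁻¹) 1))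
      rw [regMatrix_apply, regMatrix_apply, ← act_mul (s * t⁻¹)]
      simp
    · intro H
      refine ⟨ofCoeff α fun g => α g (M g 1), ?_⟩
      ext s t
      change regMatrix _ s t = _
      rw [regMatrix_apply, H s t]
      rfl
  rw [hr]
  have hc : ∀ s t : G, Continuous fun M : CStarMatrix G G A => M s t := fun s t =>
    (continuous_apply t).comp (continuous_apply s)
  exact isClosed_iInter fun s => isClosed_iInter fun t => isClosed_eq (hc s t)
    ((isometry_starAut _).continuous.comp ((isometry_starAut _).continuous.comp (hc _ _)))

/- The norm of matrices over a C⋆-algebra is stated in Mathlib with reference to the canonical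
partial order of the C⋆-algebra, in which the positive elements are the `x⋆ x`. -/
attribute [local instance] CStarAlgebra.spectralOrder CStarAlgebra.spectralOrderedRing

/-- The norm of the crossed product: `‖f‖` is the operator norm of the matrix of `f`. -/
instance : NormedRing (CrossedProduct α) :=
  NormedRing.induced (CrossedProduct α) (CStarMatrix G G A) (regRep α) regMatrix_injective

lemma norm_def (f : CrossedProduct α) : ‖f‖ = ‖regRep α f‖ := rfl

lemma isometry_regRep : Isometry (regRep α) :=
  AddMonoidHomClass.isometry_of_norm _ fun _ => rfl

instance : CompleteSpace (CrossedProduct α) :=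
  (completeSpace_iff_isComplete_range isometry_regRep.isUniformInducing).2
    isClosed_range_regRep.isComplete

/-- The crossed product is a C⋆-algebra. -/
instance : CStarAlgebra (CrossedProduct α) where
  __ := (inferInstance : NormedRing (CrossedProduct α))
  __ := (inferInstance : StarRing (CrossedProduct α))
  __ := (inferInstance : Algebra ℂ (CrossedProduct α))
  __ := (inferInstance : StarModule ℂ (CrossedProduct α))
  __ := (inferInstance : CompleteSpace (CrossedProduct α))
  norm_smul_le c f := by
    rw [norm_def, norm_def, map_smul]
    exact norm_smul_le _ _
  norm_mul_self_le f := by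
    rw [norm_def, norm_def, map_mul, map_star]
    exact CStarRing.norm_star_mul_self.symm.le

end CrossedProduct

end RokhlinLP

end

/-!
The Rokhlin projections make the inclusions of the fixed point algebra and of the crossed product
into their sequence algebras factor through algebras with the LP property.

Put `e = e₁`, represented by a sequence `E n` of self-adjoint elements of `A`. In the sequence
algebra of `A ⋊ G` one has `e_g = u_g e u_g⁻¹`, and these projections commute with `A` and are
mutually orthogonal, since they sum to `1`. Hence the elements `u_s e u_t⁻¹` are matrix units
commuting suitably with `A`, and `M ↦ ∑ s t, u_s e M(s, t) e u_t⁻¹` is a star homomorphism from the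
`G × G` matrices over `A` to `(A ⋊ G)^∞` (`matrixAmplification_mul`). It takes the matrix of `f` in
the regular representation to the constant sequence `f` (`matrixAmplification_regMatrix`).
Restricted to matrices with constant diagonal `a` it is `a ↦ ∑ g, α_g(e a e)`, which takes
values in sequences of fixed points and leaves fixed points unchanged (`averaging`, `incl_averaging`).

Matrix algebras over `A` inherit the LP property, because `p ⊗ e_ij` is a combination of the
projections `p ⊗ q` with `q` of rank one (`HasLP.cstarMatrix`). A linear combination of projections
close to the matrix of `f` is thus taken to a linear combination of projections of the sequence
algebra close to `f`, and these are approximated by projections of the algebra itself, as a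
self-adjoint almost idempotent element is close to a projection
(`exists_isStarProjection_norm_sub_le`). This last step is `HasLP.of_asymptotic_maps`, which is
phrased with the maps at finite stages `n` in place of the sequence algebra.
-/

noncomputable section

namespace RokhlinLP

open Filter Topology

/-! ### Perturbing approximate projections -/

/-- A self-adjoint element that is nearly idempotent is close to a projection: its spectrum avoids
`1 / 2`, so the indicator function of `[1 / 2, ∞)` can be applied to it. -/
lemma exists_isStarProjection_norm_sub_le {B : Type*} [CStarAlgebra B] {a : B}
    (ha : IsSelfAdjoint a) {η : ℝ} (hη : η < 1 / 4) (h : ‖a * a - a‖ ≤ η) :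
    ∃ q : B, IsStarProjection q ∧ ‖q - a‖ ≤ 2 * η := by
  have hcfc : cfc (fun t : ℝ => t * t - t) a = a * a - a := by
    rw [cfc_sub (fun t : ℝ => t * t) (fun t => t) a, cfc_mul (fun t : ℝ => t) (fun t => t) a,
      cfc_id' ℝ a]
  have hspec : ∀ t ∈ spectrum ℝ a, |t * t - t| ≤ η := fun t ht => by
    rw [← Real.norm_eq_abs]
    refine (norm_apply_le_norm_cfc (fun t : ℝ => t * t - t) a ht).trans ?_
    rwa [hcfc]
  have hη0 : 0 ≤ η := (norm_nonneg _).trans h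
  set f : ℝ → ℝ := fun t => if 1 / 2 ≤ t then 1 else 0 with hf
  have hcont : ContinuousOn f (spectrum ℝ a) := by
    intro t ht
    have hne : t ≠ 1 / 2 := by
      rintro rfl
      have := hspec _ ht
      norm_num [abs_of_neg] at this
      linarith
    refine ContinuousAt.continuousWithinAt ?_
    rcases lt_or_gt_of_ne hne with hlt | hgt
    · refine (continuousAt_const (y := (0 : ℝ))).congr ?_
      filter_upwards [Iio_mem_nhds hlt] with s hs
      exact (if_neg (not_le.2 hs)).symm
    · refine (continuousAt_const (y := (1 : ℝ))).congr ?_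
      filter_upwards [Ioi_mem_nhds hgt] with s hs
      exact (if_pos (le_of_lt hs)).symm
  refine ⟨cfc f a, ⟨?_, cfc_predicate f a⟩, ?_⟩
  · rw [IsIdempotentElem, ← cfc_mul f f a]
    congr 1
    ext t
    simp only [hf]
    split_ifs <;> simp
  · have hsub : cfc f a - a = cfc (fun t => f t - t) a := by
      rw [cfc_sub f (fun t => t) a, cfc_id' ℝ a]
    rw [hsub]
    refine norm_cfc_le (by positivity) fun t ht => ?_
    have := hspec t ht
    rw [show t * t - t = t * (t - 1) by ring, abs_mul] at this
    simp only [hf, Real.norm_eq_abs]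
    split_ifs with h1
    · rw [abs_sub_comm 1 t]
      have : 1 / 2 ≤ |t| := h1.trans (le_abs_self t)
      nlinarith [abs_nonneg (t - 1)]
    · rw [zero_sub, abs_neg]
      have : 1 / 2 ≤ |t - 1| := by
        rw [abs_sub_comm]
        exact le_trans (by linarith) (le_abs_self _)
      nlinarith [abs_nonneg t]

/-- The LP property passes from `D` to `B` along a sequence of uniformly bounded linear maps
`D → B` which preserve self-adjointness, are asymptotically idempotent on projections, and recover
every element of `B` as the limit of the images of a fixed element of `D`. -/
theorem HasLP.of_asymptotic_maps {D B : Type*} [CStarAlgebra D] [CStarAlgebra B] (hD : HasLP D)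
    (ψ : ℕ → D →ₗ[ℂ] B) {C : ℝ} (hbound : ∀ n d, ‖ψ n d‖ ≤ C * ‖d‖)
    (hstar : ∀ n d, IsSelfAdjoint d → IsSelfAdjoint (ψ n d))
    (hmul : ∀ p : D, IsStarProjection p →
      Tendsto (fun n => ψ n p * ψ n p - ψ n p) atTop (𝓝 0))
    (hlim : ∀ b : B, ∃ d : D, Tendsto (fun n => ψ n d) atTop (𝓝 b)) : HasLP B := by
  have key : ∀ d ∈ Submodule.span ℂ {p : D | IsStarProjection p}, ∀ ε > 0, ∀ᶠ n in atTop,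
      ∃ s ∈ Submodule.span ℂ {p : B | IsStarProjection p}, ‖s - ψ n d‖ < ε := by
    intro d hd
    induction hd using Submodule.span_induction with
    | mem p hp =>
      intro ε hε
      have hδ : (0 : ℝ) < min (1 / 5) (ε / 3) := by positivity
      filter_upwards [(hmul p hp).eventually (Metric.closedBall_mem_nhds 0 hδ)] with n hn
      rw [dist_zero_right] at hn
      obtain ⟨q, hq, hqn⟩ := exists_isStarProjection_norm_sub_le (hstar n p hp.isSelfAdjoint)
        ((min_le_left _ _).trans_lt (by norm_num)) hn
      refine ⟨q, Submodule.subset_span hq, ?_⟩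
      have := min_le_right (1 / 5) (ε / 3)
      linarith
    | zero =>
      intro ε hε
      exact .of_forall fun n => ⟨0, zero_mem _, by simpa using hε⟩
    | add x y _ _ hx hy =>
      intro ε hε
      filter_upwards [hx (ε / 2) (half_pos hε), hy (ε / 2) (half_pos hε)] with n
      rintro ⟨s, hs, hsn⟩ ⟨t, ht, htn⟩
      refine ⟨s + t, add_mem hs ht, ?_⟩
      rw [map_add, add_sub_add_comm]
      exact (norm_add_le _ _).trans_lt (by linarith)
    | smul c x _ hx =>
      intro ε hε
      filter_upwards [hx (ε / (‖c‖ + 1)) (by positivity)] with n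
      rintro ⟨s, hs, hsn⟩
      refine ⟨c • s, Submodule.smul_mem _ c hs, ?_⟩
      rw [map_smul, ← smul_sub, norm_smul]
      rw [lt_div_iff₀ (by positivity)] at hsn
      nlinarith [norm_nonneg (s - ψ n x)]
  intro b
  rw [Metric.mem_closure_iff]
  intro ε hε
  obtain ⟨d, hd⟩ := hlim b
  obtain ⟨d', hd', hdd'⟩ := Metric.mem_closure_iff.1 (hD d) (ε / (3 * (|C| + 1))) (by positivity)
  obtain ⟨n, hn, s, hs, hsn⟩ := ((hd.eventually (Metric.ball_mem_nhds b
    (show 0 < ε / 3 by positivity))).and (key d' hd' (ε / 3) (by positivity))).exists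
  refine ⟨s, hs, ?_⟩
  have h1 : dist b (ψ n d) < ε / 3 := by rw [dist_comm]; exact hn
  have h2 : dist (ψ n d) (ψ n d') ≤ ε / 3 := by
    rw [dist_eq_norm, ← map_sub]
    rw [dist_eq_norm, lt_div_iff₀ (by positivity)] at hdd'
    have := hbound n (d - d')
    nlinarith [le_abs_self C, norm_nonneg (d - d')]
  have h3 : dist (ψ n d') s < ε / 3 := by rwa [dist_comm, dist_eq_norm]
  linarith [dist_triangle4 b (ψ n d) (ψ n d') s]

/-! ### Matrix algebras -/

section Matrices

-- The C⋆-norm of matrices over `A` requires a star order on `A`; the spectral order provides one.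
attribute [local instance] CStarAlgebra.spectralOrder CStarAlgebra.spectralOrderedRing

variable {ι A : Type*} [DecidableEq ι] [CStarAlgebra A]

/-- The matrix with all entries `0`, except for `a` at position `(i, j)`. -/
def matrixSingle (i j : ι) : A →ₗ[ℂ] CStarMatrix ι ι A :=
  CStarMatrix.ofMatrixₗ.toLinearMap ∘ₗ Matrix.singleLinearMap ℂ i j

lemma matrixSingle_apply (i j s t : ι) (a : A) :
    matrixSingle i j a s t = if i = s ∧ j = t then a else 0 := by
  change Matrix.single i j a s t = _
  rw [Matrix.single_apply]

lemma matrixSingle_mul [Fintype ι] (i j k l : ι) (a b : A) :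
    matrixSingle i j a * matrixSingle k l b = if j = k then matrixSingle i l (a * b) else 0 := by
  change (Matrix.single i j a * Matrix.single k l b : Matrix ι ι A) = _
  split_ifs with h
  · subst h
    exact Matrix.single_mul_single_same _ _ _ _ _
  · exact Matrix.single_mul_single_of_ne _ _ _ _ h _

lemma star_matrixSingle (i j : ι) (a : A) :
    star (matrixSingle i j a) = matrixSingle j i (star a) := by
  change (Matrix.single i j a).conjTranspose = _
  exact Matrix.conjTranspose_single _ _ _

lemma continuous_matrixSingle [Fintype ι] (i j : ι) :
    Continuous (matrixSingle i j : A → CStarMatrix ι ι A) := by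
  refine continuous_pi fun s => continuous_pi fun t => ?_
  simp only [matrixSingle_apply]
  split_ifs
  exacts [continuous_id, continuous_const]

lemma isStarProjection_matrixSingle [Fintype ι] (i : ι) {p : A} (hp : IsStarProjection p) :
    IsStarProjection (matrixSingle i i p) :=
  ⟨by rw [IsIdempotentElem, matrixSingle_mul, if_pos rfl, hp.isIdempotentElem.eq],
    by rw [IsSelfAdjoint, star_matrixSingle, hp.isSelfAdjoint.star_eq]⟩

/-- For a projection `p` and `|ω| = 1`, `p` tensored with the projection of `ℂ²` onto the span of
`(1, ω)` is a projection. -/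
lemma isStarProjection_rankOne [Fintype ι] {i j : ι} (hij : i ≠ j) {p : A}
    (hp : IsStarProjection p) {ω : ℂ} (hω : star ω * ω = 1) :
    IsStarProjection ((1 / 2 : ℂ) • (matrixSingle i i p + matrixSingle j j p +
      star ω • matrixSingle i j p + ω • matrixSingle j i p)) := by
  have hω' : ω * star ω = 1 := by rw [mul_comm, hω]
  constructor
  · rw [IsIdempotentElem]
    simp only [mul_add, add_mul, smul_mul_assoc, mul_smul_comm, matrixSingle_mul, if_true,
      if_neg hij, if_neg hij.symm, hp.isIdempotentElem.eq, smul_zero, smul_smul, add_zero, zero_add]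
    match_scalars <;> first | ring1 | linear_combination (1 / 4) * hω'
  · rw [IsSelfAdjoint]
    simp only [star_smul, star_add, star_matrixSingle, hp.isSelfAdjoint.star_eq, star_star]
    rw [show star (1 / 2 : ℂ) = 1 / 2 by simp]
    congr 1
    abel

/-- If `A` has the LP property, then so do the matrix algebras over `A`. -/
theorem HasLP.cstarMatrix [Fintype ι] (hA : HasLP A) : HasLP (CStarMatrix ι ι A) := by
  set S := Submodule.span ℂ {p : CStarMatrix ι ι A | IsStarProjection p}
  have hproj : ∀ i j, ∀ p : A, IsStarProjection p → matrixSingle i j p ∈ S := by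
    intro i j p hp
    by_cases hij : i = j
    · subst hij
      exact Submodule.subset_span (isStarProjection_matrixSingle i hp)
    -- polarization: the off-diagonal unit is a combination of the two diagonal ones and of the
    -- rank one projections for `ω = 1` and `ω = I`
    have h1 := Submodule.subset_span (R := ℂ) (isStarProjection_rankOne hij hp (ω := 1) (by simp))
    have h2 := Submodule.subset_span (R := ℂ)
      (isStarProjection_rankOne hij hp (ω := Complex.I) (by simp))
    have h3 := Submodule.subset_span (R := ℂ) (isStarProjection_matrixSingle i hp)
    have h4 := Submodule.subset_span (R := ℂ) (isStarProjection_matrixSingle j hp)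
    have := add_mem (add_mem h1 (Submodule.smul_mem _ Complex.I h2))
      (Submodule.smul_mem _ (-(1 + Complex.I) / 2) (add_mem h3 h4))
    refine (congrArg (· ∈ S) ?_).mp this
    simp only [star_one, Complex.star_def, Complex.conj_I]
    have hI : Complex.I * Complex.I = -1 := Complex.I_mul_I
    match_scalars <;>
      first | ring1 | linear_combination (1 / 2) * hI | linear_combination (-1 / 2) * hI
  have hsingle : ∀ i j, ∀ a : A, matrixSingle i j a ∈ S.topologicalClosure := by
    intro i j a
    have hle : Submodule.span ℂ {p : A | IsStarProjection p} ≤ S.comap (matrixSingle i j) :=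
      Submodule.span_le.2 fun p hp => hproj i j p hp
    exact map_mem_closure (continuous_matrixSingle i j) (hA a) fun x hx => hle hx
  intro M
  have hM : M = ∑ i, ∑ j, matrixSingle i j (M i j) :=
    Matrix.matrix_eq_sum_single (M : Matrix ι ι A)
  rw [hM]
  exact Submodule.sum_mem S.topologicalClosure fun i _ => Submodule.sum_mem _ fun j _ =>
    hsingle i j _

end Matrices

/-! ### The sequence algebra -/

section Sequences

variable {A B : Type*} [CStarAlgebra A] [CStarAlgebra B]

lemma mk_eq_mk_iff {x y : BddSeq A} :
    Ideal.Quotient.mk (c0 A) x = Ideal.Quotient.mk (c0 A) y ↔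
      Tendsto (fun n => x n - y n) atTop (𝓝 0) := by
  rw [Ideal.Quotient.eq, tendsto_zero_iff_norm_tendsto_zero]
  rfl

/-- The embedding of `A` into the bounded sequences as the constant sequences. -/
def bddConst (A : Type*) [CStarAlgebra A] : A →+* BddSeq A where
  toFun := BoundedContinuousFunction.const ℕ
  map_one' := rfl
  map_mul' _ _ := rfl
  map_zero' := rfl
  map_add' _ _ := rfl

/-- The evaluation of bounded sequences at `n`. -/
def bddEval (A : Type*) [CStarAlgebra A] (n : ℕ) : BddSeq A →+* A where
  toFun x := x n
  map_one' := rfl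
  map_mul' _ _ := rfl
  map_zero' := rfl
  map_add' _ _ := rfl

/-- The pointwise application of a star homomorphism to bounded sequences. -/
def bddMap (φ : A →⋆ₐ[ℂ] B) : BddSeq A →+* BddSeq B where
  toFun x := BoundedContinuousFunction.ofNormedAddCommGroupDiscrete (fun n => φ (x n)) ‖x‖
    (fun n => (NonUnitalStarAlgHom.norm_apply_le φ (x n)).trans (x.norm_coe_le_norm n))
  map_one' := by ext n; exact map_one φ
  map_mul' x y := by ext n; exact map_mul φ (x n) (y n)
  map_zero' := by ext n; exact map_zero φ
  map_add' x y := by ext n; exact map_add φ (x n) (y n)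

/-- The ring homomorphism `A^∞ → B^∞` induced by a star homomorphism `A → B`. -/
def seqMap (φ : A →⋆ₐ[ℂ] B) : SeqAlg A →+* SeqAlg B :=
  Ideal.quotientMap (c0 B) (bddMap φ) (by
    intro x hx
    exact squeeze_zero (fun n => norm_nonneg _)
      (fun n => NonUnitalStarAlgHom.norm_apply_le φ (x n)) hx)

lemma seqMap_mk (φ : A →⋆ₐ[ℂ] B) (x : BddSeq A) :
    seqMap φ (Ideal.Quotient.mk (c0 A) x) = Ideal.Quotient.mk (c0 B) (bddMap φ x) := rfl

lemma seqMap_constSeq (φ : A →⋆ₐ[ℂ] B) (a : A) : seqMap φ (constSeq a) = constSeq (φ a) := by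
  rw [constSeq, seqMap_mk, constSeq]
  congr 1

attribute [local instance] CStarAlgebra.spectralOrder CStarAlgebra.spectralOrderedRing

/-- In `A^∞`, a sum of elements `x⋆ x` vanishes only if all summands do, since this holds
quantitatively in `A` by positivity. -/
lemma eq_zero_of_sum_star_mul_self_eq_zero {κ : Type*} (s : Finset κ) (x : κ → SeqAlg A)
    (h : ∑ i ∈ s, star (x i) * x i = 0) {i : κ} (hi : i ∈ s) : x i = 0 := by
  choose y hy using fun i => Ideal.Quotient.mk_surjective (I := c0 A) (x i)
  obtain rfl : (fun i => Ideal.Quotient.mk (c0 A) (y i)) = x := funext hy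
  simp only [star_mk, ← map_mul, ← map_sum] at h
  rw [← map_zero (Ideal.Quotient.mk (c0 A)), mk_eq_mk_iff] at h
  change Ideal.Quotient.mk (c0 A) (y i) = 0
  rw [← map_zero (Ideal.Quotient.mk (c0 A)), mk_eq_mk_iff]
  have hle : ∀ n, ‖y i n‖ ^ 2 ≤ ‖∑ j ∈ s, star (y j n) * y j n‖ := by
    intro n
    rw [sq, ← CStarRing.norm_star_mul_self]
    exact CStarAlgebra.norm_le_norm_of_nonneg_of_le (star_mul_self_nonneg _)
      (Finset.single_le_sum (f := fun j => star (y j n) * y j n)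
        (fun j _ => star_mul_self_nonneg _) hi)
  have h2 : Tendsto (fun n => ‖∑ j ∈ s, star (y j n) * y j n‖) atTop (𝓝 0) := by
    rw [tendsto_zero_iff_norm_tendsto_zero] at h
    refine h.congr fun n => ?_
    simp [BoundedContinuousFunction.sum_apply]
  have h3 := squeeze_zero (fun n => sq_nonneg _) hle h2
  rw [tendsto_zero_iff_norm_tendsto_zero]
  have h4 := h3.sqrt
  rw [Real.sqrt_zero] at h4
  refine h4.congr fun n => ?_
  rw [Real.sqrt_sq (norm_nonneg _)]
  simp

/-- Projections of `A^∞` with sum `1` are mutually orthogonal. -/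
lemma mul_eq_zero_of_sum_eq_one {κ : Type*} [Fintype κ] [DecidableEq κ] {e : κ → SeqAlg A}
    (he : ∀ i, IsStarProjection (e i)) (hsum : ∑ i, e i = 1) {i j : κ} (hij : i ≠ j) :
    e i * e j = 0 := by
  have hterm : ∀ k, star (e k * e j) * (e k * e j) = e j * e k * e j := fun k => by
    rw [star_mul, (he k).isSelfAdjoint.star_eq, (he j).isSelfAdjoint.star_eq, mul_assoc,
      ← mul_assoc (e k), (he k).isIdempotentElem.eq, mul_assoc]
  have htot : ∑ k, e j * e k * e j = e j := by
    rw [← Finset.sum_mul, ← Finset.mul_sum, hsum, mul_one, (he j).isIdempotentElem.eq]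
  rw [← Finset.add_sum_erase _ _ (Finset.mem_univ j), (he j).isIdempotentElem.eq,
    (he j).isIdempotentElem.eq, add_eq_left] at htot
  refine eq_zero_of_sum_star_mul_self_eq_zero (Finset.univ.erase j) (fun k => e k * e j) ?_
    (Finset.mem_erase.2 ⟨hij, Finset.mem_univ i⟩)
  simpa only [hterm] using htot

/-- Self-adjoint elements of `A^∞` lift to sequences of self-adjoint elements. -/
lemma exists_isSelfAdjoint_lift {e : SeqAlg A} (he : IsSelfAdjoint e) :
    ∃ E : BddSeq A, (∀ n, IsSelfAdjoint (E n)) ∧ Ideal.Quotient.mk (c0 A) E = e := by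
  obtain ⟨x, rfl⟩ := Ideal.Quotient.mk_surjective e
  have h : Tendsto (fun n => star (x n) - x n) atTop (𝓝 0) :=
    mk_eq_mk_iff.1 he
  refine ⟨(1 / 2 : ℂ) • (x + star x), fun n => ?_, mk_eq_mk_iff.2 ?_⟩
  · change star ((1 / 2 : ℂ) • (x n + star (x n))) = (1 / 2 : ℂ) • (x n + star (x n))
    rw [star_smul, star_add, star_star, add_comm]
    simp
  · have := h.const_smul (1 / 2 : ℂ)
    rw [smul_zero] at this
    refine this.congr fun n => ?_
    change _ = (1 / 2 : ℂ) • (x n + star (x n)) - x n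
    module

/-- A bounded sequence of self-adjoint elements representing the Rokhlin projection `e₁`, the
other Rokhlin projections being its translates. -/
lemma HasRokhlin.exists_seq {G : Type*} [Group G] [Fintype G] [DecidableEq G]
    {α : G →* (A ≃⋆ₐ[ℂ] A)} (hα : HasRokhlin α) :
    ∃ E : BddSeq A, (∀ n, IsSelfAdjoint (E n)) ∧
      IsIdempotentElem (Ideal.Quotient.mk (c0 A) E) ∧
      (∀ a, Commute (Ideal.Quotient.mk (c0 A) E) (constSeq a)) ∧
      (∀ g, g ≠ 1 →
        Ideal.Quotient.mk (c0 A) E * seqAlgMap (α g) (Ideal.Quotient.mk (c0 A) E) = 0) ∧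
      ∑ g, seqAlgMap (α g) (Ideal.Quotient.mk (c0 A) E) = 1 := by
  obtain ⟨e, hcomm, hproj, hsum, hact⟩ := hα
  obtain ⟨E, hE, hEe⟩ := exists_isSelfAdjoint_lift (hproj 1).isSelfAdjoint
  have hact' : ∀ g, seqAlgMap (α g) (e 1) = e g := fun g => by rw [hact, mul_one]
  refine ⟨E, hE, ?_⟩
  rw [hEe]
  simp only [hact']
  refine ⟨(hproj 1).isIdempotentElem, fun a => ?_, fun g hg => ?_, hsum⟩
  · exact (Subring.mem_centralizer_iff.1 (hcomm 1) _ ⟨a, rfl⟩).symm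
  · exact mul_eq_zero_of_sum_eq_one hproj hsum hg.symm

end Sequences

/-! ### Matrix units from a covariant representation -/

section Compression

variable {G A R S : Type*} [Group G] [Fintype G] [CStarAlgebra A] [Ring R] [Ring S]

/-- The map `M ↦ ∑ s t, u_s e c(M s t) e u_t⁻¹`. When `e` is a projection which commutes with the
range of `c` and whose translates `u_g e u_g⁻¹` are orthogonal, the elements `u_s e u_t⁻¹` are
matrix units, and this is the corresponding homomorphism on matrices over `A`. -/
def matrixAmplification (U : G →* R) (c : A →+* R) (e : R) (M : CStarMatrix G G A) : R :=
  ∑ s, ∑ t, U s * e * c (M s t) * e * U t⁻¹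

lemma map_matrixAmplification (f : R →+* S) (U : G →* R) (c : A →+* R) (e : R)
    (M : CStarMatrix G G A) :
    f (matrixAmplification U c e M) =
      matrixAmplification ((f : R →* S).comp U) (f.comp c) (f e) M := by
  simp [matrixAmplification]

lemma matrixAmplification_mul [DecidableEq G] {U : G →* R} {c : A →+* R} {e : R}
    (he : IsIdempotentElem e) (hc : ∀ a, Commute e (c a)) (ho : ∀ g, g ≠ 1 → e * U g * e = 0)
    (M N : CStarMatrix G G A) :
    matrixAmplification U c e M * matrixAmplification U c e N =
      matrixAmplification U c e (M * N) := by
  have hmid : ∀ t k, e * (U t⁻¹ * U k) * e = if t = k then e else 0 := by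
    intro t k
    rw [← map_mul]
    split_ifs with h
    · rw [h, inv_mul_cancel, map_one, mul_one, he.eq]
    · exact ho _ (by rwa [Ne, inv_mul_eq_one])
  have hterm : ∀ s t k l, U s * e * c (M s t) * e * U t⁻¹ * (U k * e * c (N k l) * e * U l⁻¹) =
      if t = k then U s * e * c (M s t * N k l) * e * U l⁻¹ else 0 := by
    intro s t k l
    calc _ = U s * e * c (M s t) * (e * (U t⁻¹ * U k) * e) * c (N k l) * e * U l⁻¹ := by
          simp only [mul_assoc]
      _ = _ := by
          rw [hmid]
          split_ifs
          · rw [mul_assoc _ e (c (N k l)), (hc _).eq, ← mul_assoc, map_mul, ← mul_assoc,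
              mul_assoc _ e e, he.eq]
          · simp
  rw [matrixAmplification, Finset.sum_mul]
  refine Finset.sum_congr rfl fun s _ => ?_
  have hinner : ∀ t, U s * e * c (M s t) * e * U t⁻¹ * matrixAmplification U c e N =
      ∑ l, U s * e * c (M s t * N t l) * e * U l⁻¹ := by
    intro t
    simp_rw [matrixAmplification, Finset.mul_sum, hterm]
    rw [Finset.sum_comm]
    simp
  rw [Finset.sum_mul, Finset.sum_congr rfl fun t _ => hinner t, Finset.sum_comm]
  refine Finset.sum_congr rfl fun l _ => ?_
  rw [CStarMatrix.mul_apply, map_sum, Finset.mul_sum, Finset.sum_mul, Finset.sum_mul]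

/-- On the matrices of the regular representation, the amplification takes `∑ k, a_k u_k` to its
image under the covariant representation `(c, U)`, because the translates of `e` sum to `1`. -/
lemma matrixAmplification_regMatrix [DecidableEq G] {α : G →* (A ≃⋆ₐ[ℂ] A)} {U : G →* R}
    {c : A →+* R} {e : R} (he : IsIdempotentElem e) (hc : ∀ a, Commute e (c a))
    (hcov : ∀ g a, U g * c a = c (α g a) * U g) (hsum : ∑ g, U g * e * U g⁻¹ = 1)
    (f : CrossedProduct α) :
    matrixAmplification U c e f.regMatrix = ∑ k, c (f.coeff k) * U k := by
  have hterm : ∀ s t, U s * e * c (f.regMatrix s t) * e * U t⁻¹ =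
      c (f.coeff (s * t⁻¹)) * (U s * e * U s⁻¹) * U (s * t⁻¹) := by
    intro s t
    rw [CrossedProduct.regMatrix_apply, mul_assoc (U s), (hc _).eq, ← mul_assoc, hcov,
      ← CrossedProduct.act_mul, mul_inv_cancel, CrossedProduct.act_one, mul_assoc _ e e, he.eq,
      map_mul]
    have : U s⁻¹ * U s = 1 := by rw [← map_mul, inv_mul_cancel, map_one]
    simp only [mul_assoc]
    rw [← mul_assoc (U s⁻¹), this, one_mul]
  have hre : ∀ s, ∑ t, U s * e * c (f.regMatrix s t) * e * U t⁻¹ =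
      ∑ k, c (f.coeff k) * (U s * e * U s⁻¹) * U k := fun s =>
    Fintype.sum_equiv ((Equiv.inv G).trans (Equiv.mulLeft s)) _ _ fun t => hterm s t
  simp only [matrixAmplification, hre]
  rw [Finset.sum_comm]
  refine Finset.sum_congr rfl fun k _ => ?_
  rw [← Finset.sum_mul, ← Finset.mul_sum, hsum, mul_one]

end Compression

/-! ### Coefficients and canonical unitaries of the crossed product -/

namespace CrossedProduct

variable {G A : Type*} [Group G] [Fintype G] [DecidableEq G] [CStarAlgebra A]

/-- The embedding `a ↦ a u_1` of the coefficient algebra into the crossed product. -/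
def incl (α : G →* (A ≃⋆ₐ[ℂ] A)) : A →⋆ₐ[ℂ] CrossedProduct α where
  toFun a := ofCoeff α (Pi.single 1 a)
  map_one' := rfl
  map_mul' a b := by
    ext g
    rw [coeff_mul, Finset.sum_eq_single 1 (fun k _ hk => by simp [hk]) (by simp)]
    by_cases hg : g = 1 <;> simp [hg]
  map_zero' := by ext g; simp
  map_add' a b := by ext g; simp [Pi.single_add]
  commutes' c := by
    rw [Algebra.algebraMap_eq_smul_one, Algebra.algebraMap_eq_smul_one]
    ext g
    rw [coeff_ofCoeff, Pi.single_smul]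
    rfl
  map_star' a := by
    ext g
    rw [coeff_star]
    by_cases hg : g = 1 <;> simp [hg]

lemma coeff_incl (α : G →* (A ≃⋆ₐ[ℂ] A)) (a : A) (g : G) :
    (incl α a).coeff g = if g = 1 then a else 0 :=
  Pi.single_apply 1 a g

lemma incl_injective (α : G →* (A ≃⋆ₐ[ℂ] A)) : Function.Injective (incl α) := fun a b h => by
  have := congrArg (fun f => f.coeff 1) h
  simpa [coeff_incl] using this

lemma isometry_incl (α : G →* (A ≃⋆ₐ[ℂ] A)) : Isometry (incl α) :=
  NonUnitalStarAlgHom.isometry (incl α : A →⋆ₙₐ[ℂ] CrossedProduct α) (incl_injective α)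

/-- The canonical unitaries `u_g`. -/
def unit (α : G →* (A ≃⋆ₐ[ℂ] A)) : G →* CrossedProduct α where
  toFun g := ofCoeff α (Pi.single g 1)
  map_one' := rfl
  map_mul' g h := by
    ext k
    rw [coeff_mul, Finset.sum_eq_single g (fun l _ hl => by simp [hl]) (by simp)]
    by_cases hk : k = g * h
    · simp [hk]
    · have : g⁻¹ * k ≠ h := fun h' => hk (by rw [← h', mul_inv_cancel_left])
      simp [hk, this]

lemma coeff_unit (α : G →* (A ≃⋆ₐ[ℂ] A)) (g k : G) :
    (unit α g).coeff k = if k = g then 1 else 0 :=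
  Pi.single_apply g 1 k

lemma star_unit (α : G →* (A ≃⋆ₐ[ℂ] A)) (g : G) : star (unit α g) = unit α g⁻¹ := by
  ext k
  rw [coeff_star, coeff_unit, coeff_unit]
  by_cases hk : k = g⁻¹
  · simp [hk]
  · rw [if_neg hk, if_neg fun h => hk (by rw [← h, inv_inv]), star_zero, map_zero]

lemma coeff_incl_mul (α : G →* (A ≃⋆ₐ[ℂ] A)) (a : A) (f : CrossedProduct α) (g : G) :
    (incl α a * f).coeff g = a * f.coeff g := by
  rw [coeff_mul, Finset.sum_eq_single 1 (fun k _ hk => by simp [coeff_incl, hk]) (by simp)]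
  simp [coeff_incl]

lemma unit_mul_incl (α : G →* (A ≃⋆ₐ[ℂ] A)) (g : G) (a : A) :
    unit α g * incl α a = incl α (α g a) * unit α g := by
  ext k
  rw [coeff_incl_mul, coeff_unit, coeff_mul,
    Finset.sum_eq_single g (fun l _ hl => by simp [coeff_unit, hl]) (by simp), coeff_unit,
    coeff_incl]
  by_cases hk : k = g
  · simp [hk]
  · have : g⁻¹ * k ≠ 1 := fun h' => hk (inv_mul_eq_one.1 h').symm
    simp [hk, this]

lemma unit_mul_incl_mul_unit_inv (α : G →* (A ≃⋆ₐ[ℂ] A)) (g : G) (a : A) :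
    unit α g * incl α a * unit α g⁻¹ = incl α (α g a) := by
  rw [unit_mul_incl, mul_assoc, ← map_mul, mul_inv_cancel, map_one, mul_one]

lemma sum_incl_mul_unit {α : G →* (A ≃⋆ₐ[ℂ] A)} (f : CrossedProduct α) :
    ∑ k, incl α (f.coeff k) * unit α k = f := by
  ext g
  let ev : CrossedProduct α →+ A := ⟨⟨fun f => f.coeff g, rfl⟩, fun _ _ => rfl⟩
  have hev : ∀ x, x.coeff g = ev x := fun _ => rfl
  rw [hev, map_sum]
  simp only [← hev, coeff_incl_mul, coeff_unit]
  simp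

end CrossedProduct

/-! ### Asymptotic homomorphisms into the crossed product -/

section Asymptotic

open CrossedProduct

attribute [local instance] CStarAlgebra.spectralOrder CStarAlgebra.spectralOrderedRing

variable {G A : Type*} [Group G] [Fintype G] [DecidableEq G] [CStarAlgebra A]
  {α : G →* (A ≃⋆ₐ[ℂ] A)}

/-- The linear map `M ↦ ∑ s t, u_s x (M s t) x u_t⁻¹` into the crossed product, for `x : A`. -/
def amplify (α : G →* (A ≃⋆ₐ[ℂ] A)) (x : A) : CStarMatrix G G A →ₗ[ℂ] CrossedProduct α where
  toFun := matrixAmplification (unit α) (incl α : A →+* CrossedProduct α) (incl α x)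
  map_add' M N := by
    simp [matrixAmplification, mul_add, add_mul, Finset.sum_add_distrib]
  map_smul' z M := by
    simp [matrixAmplification, Finset.smul_sum]

lemma amplify_apply (x : A) (M : CStarMatrix G G A) :
    amplify α x M = ∑ s, ∑ t, unit α s * incl α x * incl α (M s t) * incl α x * unit α t⁻¹ := rfl

lemma norm_amplify_le (E : BddSeq A) (n : ℕ) (M : CStarMatrix G G A) :
    ‖amplify α (E n) M‖ ≤ (∑ s, ∑ t, ‖unit α s‖ * ‖E‖ * ‖E‖ * ‖unit α t⁻¹‖) * ‖M‖ := by
  have hn : ∀ a, ‖incl α a‖ ≤ ‖a‖ := NonUnitalStarAlgHom.norm_apply_le (incl α)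
  have hE : ‖incl α (E n)‖ ≤ ‖E‖ := (hn _).trans (E.norm_coe_le_norm n)
  rw [amplify_apply, Finset.sum_mul]
  refine norm_sum_le_of_le _ fun s _ => ?_
  rw [Finset.sum_mul]
  refine norm_sum_le_of_le _ fun t _ => ?_
  calc _ ≤ ‖unit α s‖ * ‖incl α (E n)‖ * ‖incl α (M s t)‖ * ‖incl α (E n)‖ * ‖unit α t⁻¹‖ := by
        refine (norm_mul_le _ _).trans ?_
        gcongr
        refine (norm_mul_le _ _).trans ?_
        gcongr
        refine (norm_mul_le _ _).trans ?_
        gcongr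
        exact norm_mul_le _ _
    _ ≤ ‖unit α s‖ * ‖E‖ * ‖M‖ * ‖E‖ * ‖unit α t⁻¹‖ := by
        gcongr
        exact (hn _).trans CStarMatrix.norm_entry_le_norm
    _ = _ := by ring

/-- The double sum is compressed by `x` on both sides, so that self-adjointness is preserved
exactly and not only asymptotically. -/
lemma isSelfAdjoint_amplify {x : A} (hx : IsSelfAdjoint x) {M : CStarMatrix G G A}
    (hM : IsSelfAdjoint M) : IsSelfAdjoint (amplify α x M) := by
  have hM' : ∀ s t, star (M s t) = M t s := fun s t => by
    rw [← CStarMatrix.star_apply, hM.star_eq]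
  rw [IsSelfAdjoint, amplify_apply]
  simp only [star_sum, star_mul, star_unit, ← map_star, hx.star_eq, hM', inv_inv, mul_assoc]
  exact Finset.sum_comm

/-- The bounded sequence with terms `amplify α (E n) M`. -/
def amplifySeq (α : G →* (A ≃⋆ₐ[ℂ] A)) (E : BddSeq A) (M : CStarMatrix G G A) :
    BddSeq (CrossedProduct α) :=
  matrixAmplification ((bddConst (CrossedProduct α)).toMonoidHom.comp (unit α))
    ((bddConst _).comp (incl α : A →+* CrossedProduct α)) (bddMap (incl α) E) M

lemma amplifySeq_apply (E : BddSeq A) (M : CStarMatrix G G A) (n : ℕ) :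
    amplifySeq α E M n = amplify α (E n) M := by
  change bddEval _ n (amplifySeq α E M) = _
  rw [amplifySeq, map_matrixAmplification]
  rfl

/-- The class in the sequence algebra of the crossed product of the constant sequence `u_g`. -/
def seqUnit (α : G →* (A ≃⋆ₐ[ℂ] A)) : G →* SeqAlg (CrossedProduct α) :=
  ((Ideal.Quotient.mk (c0 (CrossedProduct α))).comp (bddConst _)).toMonoidHom.comp (unit α)

/-- The embedding of `A` into the sequence algebra of the crossed product. -/
def seqIncl (α : G →* (A ≃⋆ₐ[ℂ] A)) : A →+* SeqAlg (CrossedProduct α) :=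
  (Ideal.Quotient.mk (c0 (CrossedProduct α))).comp
    ((bddConst _).comp (incl α : A →+* CrossedProduct α))

lemma mk_amplifySeq (E : BddSeq A) (M : CStarMatrix G G A) :
    Ideal.Quotient.mk (c0 (CrossedProduct α)) (amplifySeq α E M) =
      matrixAmplification (seqUnit α) (seqIncl α)
        (seqMap (incl α) (Ideal.Quotient.mk (c0 A) E)) M := by
  rw [amplifySeq, map_matrixAmplification]
  rfl

lemma seqIncl_apply (a : A) : seqIncl α a = seqMap (incl α) (constSeq a) :=
  (seqMap_constSeq (incl α) a).symm

lemma seqUnit_mul_seqIncl (g : G) (a : A) :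
    seqUnit α g * seqIncl α a = seqIncl α (α g a) * seqUnit α g := by
  have := congrArg (fun x => Ideal.Quotient.mk (c0 (CrossedProduct α)) (bddConst _ x))
    (unit_mul_incl α g a)
  simp only [map_mul] at this
  exact this

/-- The unitaries `u_g` implement the automorphisms `(α_g)^∞` in the sequence algebra of the
crossed product. -/
lemma seqUnit_mul_seqMap (g : G) (y : SeqAlg A) :
    seqUnit α g * seqMap (incl α) y * seqUnit α g⁻¹ = seqMap (incl α) (seqAlgMap (α g) y) := by
  obtain ⟨x, rfl⟩ := Ideal.Quotient.mk_surjective y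
  refine congrArg (Ideal.Quotient.mk (c0 (CrossedProduct α))) (a₁ := bddConst _ (unit α g) *
    bddMap (incl α) x * bddConst _ (unit α g⁻¹)) (a₂ := bddMap (incl α) (bddSeqMap (α g) x)) ?_
  ext n : 1
  exact unit_mul_incl_mul_unit_inv α g (x n)


/-- If `E` represents a Rokhlin projection, the maps `amplify α (E n)` are asymptotically
multiplicative; only squares of idempotents are recorded. -/
lemma tendsto_amplify_mul_self_sub {E : BddSeq A}
    (hidem : IsIdempotentElem (Ideal.Quotient.mk (c0 A) E))
    (hcomm : ∀ a, Commute (Ideal.Quotient.mk (c0 A) E) (constSeq a))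
    (horth : ∀ g, g ≠ 1 →
      Ideal.Quotient.mk (c0 A) E * seqAlgMap (α g) (Ideal.Quotient.mk (c0 A) E) = 0)
    {M : CStarMatrix G G A} (hM : IsIdempotentElem M) :
    Tendsto (fun n => amplify α (E n) M * amplify α (E n) M - amplify α (E n) M) atTop (𝓝 0) := by
  have h := matrixAmplification_mul (U := seqUnit α) (c := seqIncl α) (hidem.map (seqMap (incl α)))
    (fun a => by rw [seqIncl_apply]; exact (hcomm a).map (seqMap (incl α)))
    (fun g hg => by
      have hg' : seqUnit α g⁻¹ * seqUnit α g = 1 := by rw [← map_mul, inv_mul_cancel, map_one]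
      have := congrArg (seqMap (incl α)) (horth g hg)
      rw [map_mul, ← seqUnit_mul_seqMap, map_zero] at this
      have := congrArg (· * seqUnit α g) this
      simpa only [mul_assoc, hg', mul_one, zero_mul] using this) M M
  rw [hM.eq, ← mk_amplifySeq, ← map_mul, mk_eq_mk_iff] at h
  refine h.congr fun n => ?_
  rw [BoundedContinuousFunction.mul_apply, amplifySeq_apply]

/-- If `E` represents a Rokhlin projection, the maps `amplify α (E n)` are asymptotically a left
inverse of the regular representation. -/
lemma tendsto_amplify_regMatrix {E : BddSeq A}
    (hidem : IsIdempotentElem (Ideal.Quotient.mk (c0 A) E))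
    (hcomm : ∀ a, Commute (Ideal.Quotient.mk (c0 A) E) (constSeq a))
    (hsum : ∑ g, seqAlgMap (α g) (Ideal.Quotient.mk (c0 A) E) = 1) (f : CrossedProduct α) :
    Tendsto (fun n => amplify α (E n) f.regMatrix) atTop (𝓝 f) := by
  have h := matrixAmplification_regMatrix (U := seqUnit α) (c := seqIncl α)
    (hidem.map (seqMap (incl α)))
    (fun a => by rw [seqIncl_apply]; exact (hcomm a).map (seqMap (incl α)))
    seqUnit_mul_seqIncl
    (by simp only [seqUnit_mul_seqMap, ← map_sum, hsum, map_one]) f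
  have hf : ∑ k, seqIncl α (f.coeff k) * seqUnit α k =
      Ideal.Quotient.mk (c0 (CrossedProduct α)) (bddConst _ f) := by
    conv_rhs => rw [← sum_incl_mul_unit f]
    simp only [map_sum, map_mul]
    rfl
  rw [hf, ← mk_amplifySeq, mk_eq_mk_iff] at h
  rw [tendsto_iff_norm_sub_tendsto_zero]
  rw [tendsto_zero_iff_norm_tendsto_zero] at h
  refine h.congr fun n => ?_
  rw [amplifySeq_apply]
  rfl

/-- The LP property passes to crossed products by finite groups with the Rokhlin property. -/
theorem HasLP.crossedProduct (hα : HasRokhlin α) (hA : HasLP A) : HasLP (CrossedProduct α) := by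
  obtain ⟨E, hsa, hidem, hcomm, horth, hsum⟩ := hα.exists_seq
  exact (hA.cstarMatrix (ι := G)).of_asymptotic_maps (fun n => amplify α (E n))
    (fun n M => norm_amplify_le E n M)
    (fun n M hM => isSelfAdjoint_amplify (hsa n) hM)
    (fun M hM => tendsto_amplify_mul_self_sub hidem hcomm horth hM.isIdempotentElem)
    (fun f => ⟨f.regMatrix, tendsto_amplify_regMatrix hidem hcomm hsum f⟩)

/-! ### The fixed point algebra -/

/-- The linear map `a ↦ ∑ g, α_g(x a x)` into the fixed point algebra, for `x : A`. -/
def averaging (α : G →* (A ≃⋆ₐ[ℂ] A)) (x : A) : A →ₗ[ℂ] fixedPointAlgebra α where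
  toFun a := ⟨∑ g, α g (x * a * x), fun h => by
    rw [map_sum]
    exact Fintype.sum_equiv (Equiv.mulLeft h) _ _ fun g => (act_mul h g _).symm⟩
  map_add' a b := Subtype.ext (by
    simp [mul_add, add_mul, Finset.sum_add_distrib])
  map_smul' z a := Subtype.ext (by simp [Finset.smul_sum])

lemma coe_averaging (x a : A) : (averaging α x a : A) = ∑ g, α g (x * a * x) := rfl

/-- In the crossed product, `averaging` is the restriction of `amplify` to the diagonal matrices
with constant diagonal. -/
lemma incl_averaging (x a : A) :
    incl α (averaging α x a) = amplify α x (CStarMatrix.ofMatrix (Matrix.diagonal fun _ => a)) := by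
  rw [amplify_apply, coe_averaging, map_sum]
  refine Finset.sum_congr rfl fun s _ => ?_
  rw [Finset.sum_eq_single s (fun t _ ht => by simp [Matrix.diagonal_apply_ne' _ ht]) (by simp)]
  simp only [CStarMatrix.ofMatrix_apply, Matrix.diagonal_apply_eq]
  rw [← unit_mul_incl_mul_unit_inv]
  simp only [map_mul, mul_assoc]

lemma regMatrix_incl {a : A} (ha : a ∈ fixedPointAlgebra α) :
    (incl α a).regMatrix = CStarMatrix.ofMatrix (Matrix.diagonal fun _ => a) := by
  ext s t
  rw [regMatrix_apply, coeff_incl, CStarMatrix.ofMatrix_apply, Matrix.diagonal_apply]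
  simp only [mul_inv_eq_one]
  split_ifs
  exacts [ha s⁻¹, map_zero _]

/-- The LP property passes to fixed point algebras of actions of finite groups with the Rokhlin
property. -/
theorem HasLP.fixedPointAlgebra (hα : HasRokhlin α) (hA : HasLP A) :
    HasLP (fixedPointAlgebra α) := by
  obtain ⟨E, hsa, hidem, hcomm, horth, hsum⟩ := hα.exists_seq
  refine hA.of_asymptotic_maps (fun n => averaging α (E n)) (C := ∑ _g : G, ‖E‖ * ‖E‖)
    (fun n a => ?_) (fun n a ha => ?_) (fun p hp => ?_) (fun a => ⟨a, ?_⟩)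
  · change ‖∑ g, α g (E n * a * E n)‖ ≤ _
    rw [Finset.sum_mul]
    refine norm_sum_le_of_le _ fun g _ => ?_
    rw [(isometry_starAut (α g)).norm_map_of_map_zero (map_zero _)]
    calc _ ≤ ‖E n‖ * ‖a‖ * ‖E n‖ := (norm_mul_le _ _).trans (by gcongr; exact norm_mul_le _ _)
      _ ≤ ‖E‖ * ‖a‖ * ‖E‖ := by gcongr <;> exact E.norm_coe_le_norm n
      _ = _ := by ring
  · refine Subtype.ext ?_
    change star (∑ g, α g (E n * a * E n)) = ∑ g, α g (E n * a * E n)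
    simp only [star_sum, ← map_star, star_mul, (hsa n).star_eq, ha.star_eq, mul_assoc]
  · have hdiag : IsIdempotentElem
        (CStarMatrix.ofMatrix (Matrix.diagonal fun _ => p) : CStarMatrix G G A) := by
      exact (Matrix.diagonal_mul_diagonal (fun _ : G => p) _).trans
        (congrArg (fun q => Matrix.diagonal fun _ => q) hp.isIdempotentElem.eq)
    have h := tendsto_amplify_mul_self_sub hidem hcomm horth hdiag
    rw [tendsto_zero_iff_norm_tendsto_zero] at h ⊢
    refine h.congr fun n => ?_
    rw [← incl_averaging, ← map_mul, ← map_sub,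
      (isometry_incl α).norm_map_of_map_zero (map_zero _)]
    rfl
  · have h := tendsto_amplify_regMatrix hidem hcomm hsum (incl α (a : A))
    rw [regMatrix_incl a.2, tendsto_iff_norm_sub_tendsto_zero] at h
    rw [tendsto_iff_norm_sub_tendsto_zero]
    refine h.congr fun n => ?_
    rw [← incl_averaging, ← map_sub, (isometry_incl α).norm_map_of_map_zero (map_zero _)]
    rfl

end Asymptotic
end RokhlinLP
end

theorem theorem3p9 {A G : Type*} [CStarAlgebra A] [Group G] [Fintype G] [DecidableEq G]
    (hA : RokhlinLP.IsSimpleCStar A) (α : G →* (A ≃⋆ₐ[ℂ] A))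
    (hα : RokhlinLP.HasRokhlin α) (hLP : RokhlinLP.HasLP A) :
    RokhlinLP.HasLP (RokhlinLP.fixedPointAlgebra α) ∧
      RokhlinLP.HasLP (RokhlinLP.CrossedProduct α) :=
  ⟨hLP.fixedPointAlgebra hα, hLP.crossedProduct hα⟩
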